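/- For $\rho\in[0,1)$ let $$C_\rho(u,v)=\Phi_2(\Phi^{-1}(u),\Phi^{-1}(v);\rho),\qquad 0\le u,v\le 1,$$ be the Gaussian copula, where $\Phi$ is the standard normal distribution function, $\Phi^{-1}:[0,1]\to[-\infty,\infty]$ its inverse, and $$\Phi_2(s,t;\rho)=\int_{-\infty}^{s}\int_{-\infty}^{t}\frac{1}{2\pi\sqrt{1-\rho^2}}\exp\Big\{-\frac{x^2-2\rho xy+y^2}{2(1-\rho^2)}\Big\}\,dy\,dx .$$ A function $\varphi:[0,1]\to[0,1]$ is admissible if $\varphi(u)\in[u^2,1]$ for every $u\in[0,1]$, and $\varphi(u)\to0$ and $u^2/\varphi(u)\to0$ as $u\downarrow0$. For a copula $C$ and an admissible $\varphi$ put $\Pi_\varphi(u)=C(\varphi(u),u^2/\varphi(u))$, $u\in(0,1)$. An admissible function $\varphi^*$ is a function of maximal dependence for $C$ if $\Pi_{\varphi^*}(u)=\max_{\varphi\text{ admissible}}\Pi_\varphi(u)$ for all $u\in(0,1)$; the function $\Pi^*=\Pi_{\varphi^*}$ is then the same for every such $\varphi^*$. Define $$\lambda_L(C)=\lim_{u\downarrow0}\frac{C(u,u)}{u},\qquad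 \chi_L(C)=\lim_{u\downarrow0}\frac{2\log u}{\log C(u,u)}-1,$$ and let $\kappa_L(C)$ be the unique real number $\kappa$ such that $C(u,u)=\ell(u)u^{\kappa}$ for all sufficiently small $u>0$, for some function $\ell$ slowly varying at $0$ (that is, positive and measurable on some interval $(0,\delta)$ with $\ell(cu)/\ell(u)\to1$ as $u\downarrow0$ for every $c>0$). Let $\lambda_L^*(C)$, $\chi_L^*(C)$, $\kappa_L^*(C)$ be defined in the same way with $\Pi^*(u)$ in place of $C(u,u)$. Then, for every $\rho\in[0,1)$, a function of maximal dependence for $C_\rho$ exists, all six indices of $C_\rho$ exist, and (A) $\lambda_L^*(C_\rho)=\lambda_L(C_\rho)=0$; (B) $\chi_L^*(C_\rho)=\chi_L(C_\rho)=\rho$; (C) $\kappa_L^*(C_\rho)=\kappa_L(C_\rho)=2/(1+\rho)$. -/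

import Mathlib

open Set Filter Topology MeasureTheory ProbabilityTheory

noncomputable section

/-- The standard normal distribution function `Φ`. -/
def stdNormalCDF (x : ℝ) : ℝ := cdf (gaussianReal 0 1) x

/-- The inverse `Φ⁻¹ : [0,1] → [-∞,∞]` of the standard normal distribution function, as a quantile
function; in particular `Φ⁻¹(0) = -∞` and `Φ⁻¹(1) = ∞`. -/
def stdNormalQuantile (u : ℝ) : EReal :=
  sInf ((fun x : ℝ => (x : EReal)) '' {x : ℝ | u ≤ stdNormalCDF x})

/-- The density of the bivariate normal distribution with standard normal margins and
correlation `ρ`. -/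
def binormalDensity (ρ x y : ℝ) : ℝ :=
  1 / (2 * Real.pi * Real.sqrt (1 - ρ ^ 2)) *
    Real.exp (-((x ^ 2 - 2 * ρ * x * y + y ^ 2) / (2 * (1 - ρ ^ 2))))

/-- The bivariate normal distribution function `Φ₂(s,t;ρ)`, with `s, t ∈ [-∞,∞]`. -/
def binormalCDF (ρ : ℝ) (s t : EReal) : ℝ :=
  ∫ x in {x : ℝ | (x : EReal) ≤ s}, ∫ y in {y : ℝ | (y : EReal) ≤ t}, binormalDensity ρ x y

/-- The Gaussian copula `C_ρ(u,v) = Φ₂(Φ⁻¹(u), Φ⁻¹(v); ρ)`, meant for `u, v ∈ [0,1]`. -/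
def gaussianCopula (ρ u v : ℝ) : ℝ :=
  binormalCDF ρ (stdNormalQuantile u) (stdNormalQuantile v)

/-- Admissible functions `φ : [0,1] → [0,1]`. Only the values of `φ` on `[0,1]` matter. -/
structure IsAdmissible (φ : ℝ → ℝ) : Prop where
  mem_Icc : ∀ u ∈ Icc (0 : ℝ) 1, φ u ∈ Icc (u ^ 2) 1
  tendsto_fst : Tendsto φ (𝓝[>] 0) (𝓝 0)
  tendsto_snd : Tendsto (fun u => u ^ 2 / φ u) (𝓝[>] 0) (𝓝 0)

/-- `Π_φ(u) = C(φ(u), u²/φ(u))`. -/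
def pathProb (C : ℝ → ℝ → ℝ) (φ : ℝ → ℝ) (u : ℝ) : ℝ := C (φ u) (u ^ 2 / φ u)

/-- `φ` is a function of maximal dependence for `C`: it is admissible and, for every
`u ∈ (0,1)`, `Π_φ(u)` is the maximum of `Π_ψ(u)` over all admissible `ψ`. -/
def IsMaxDependence (C : ℝ → ℝ → ℝ) (φ : ℝ → ℝ) : Prop :=
  IsAdmissible φ ∧ ∀ u ∈ Ioo (0 : ℝ) 1,
    IsGreatest ((fun ψ : ℝ → ℝ => pathProb C ψ u) '' {ψ | IsAdmissible ψ}) (pathProb C φ u)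

/-- `l` is the limit of `P(u)/u` as `u ↓ 0`. -/
def HasLambda (P : ℝ → ℝ) (l : ℝ) : Prop :=
  Tendsto (fun u => P u / u) (𝓝[>] 0) (𝓝 l)

/-- `c` is the limit of `2 log u / log P(u) - 1` as `u ↓ 0`. -/
def HasChi (P : ℝ → ℝ) (c : ℝ) : Prop :=
  Tendsto (fun u => 2 * Real.log u / Real.log (P u) - 1) (𝓝[>] 0) (𝓝 c)

/-- `ℓ` is slowly varying at `0`: positive and measurable on some interval `(0,δ)`, with
`ℓ(c u)/ℓ(u) → 1` as `u ↓ 0` for every `c > 0`. -/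
def SlowlyVaryingAtZero (ℓ : ℝ → ℝ) : Prop :=
  (∃ δ > 0, (∀ u ∈ Ioo (0 : ℝ) δ, 0 < ℓ u) ∧ Measurable fun u : Ioo (0 : ℝ) δ => ℓ u) ∧
    ∀ c > 0, Tendsto (fun u => ℓ (c * u) / ℓ u) (𝓝[>] 0) (𝓝 1)

/-- `k` solves `P(u) = ℓ(u) u ^ k`, `u ↓ 0`, for some function `ℓ` slowly varying at `0`. -/
def SolvesTailEquation (P : ℝ → ℝ) (k : ℝ) : Prop :=
  ∃ ℓ : ℝ → ℝ, SlowlyVaryingAtZero ℓ ∧ ∀ᶠ u in 𝓝[>] (0 : ℝ), P u = ℓ u * u ^ k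

/-- `k` is the solution, and the only one, of the tail equation of `P`. -/
def HasKappa (P : ℝ → ℝ) (k : ℝ) : Prop :=
  SolvesTailEquation P k ∧ ∀ k', SolvesTailEquation P k' → k' = k

/-- `λ_L(C) = l`. -/
def HasLambdaL (C : ℝ → ℝ → ℝ) (l : ℝ) : Prop := HasLambda (fun u => C u u) l

/-- `χ_L(C) = c`. -/
def HasChiL (C : ℝ → ℝ → ℝ) (c : ℝ) : Prop := HasChi (fun u => C u u) c

/-- `κ_L(C) = k`. -/
def HasKappaL (C : ℝ → ℝ → ℝ) (k : ℝ) : Prop := HasKappa (fun u => C u u) k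

/-- `λ_L^*(C) = l`: functions of maximal dependence exist, and along each of them the index
is `l`. -/
def HasLambdaLStar (C : ℝ → ℝ → ℝ) (l : ℝ) : Prop :=
  (∃ φ, IsMaxDependence C φ) ∧ ∀ φ, IsMaxDependence C φ → HasLambda (pathProb C φ) l

/-- `χ_L^*(C) = c`: functions of maximal dependence exist, and along each of them the index
is `c`. -/
def HasChiLStar (C : ℝ → ℝ → ℝ) (c : ℝ) : Prop :=
  (∃ φ, IsMaxDependence C φ) ∧ ∀ φ, IsMaxDependence C φ → HasChi (pathProb C φ) c

/-- `κ_L^*(C) = k`: functions of maximal dependence exist, and along each of them the index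
is `k`. -/
def HasKappaLStar (C : ℝ → ℝ → ℝ) (k : ℝ) : Prop :=
  (∃ φ, IsMaxDependence C φ) ∧ ∀ φ, IsMaxDependence C φ → HasKappa (pathProb C φ) k

end

-- The diagonal `φ = id` is itself a function of maximal dependence, so each starred index is the
-- corresponding index of the diagonal section. Maximality: move along the hyperbola `p q = u²` by
-- `p = u eˣ`, `q = u e⁻ˣ`, with normal quantiles `s`, `t` of `p`, `q` and `r = √(1-ρ²)`. The copula
-- then has derivative `Φ(s) Φ((t-ρs)/r) - Φ(t) Φ((s-ρt)/r)`. The two argument pairs lie on one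
-- circle, and for `t ≤ s` the second is nearer to the diagonal direction because `ρ ≥ 0`. Products
-- `Φ(a) Φ(b)` grow in that direction along a circle since `x Φ(x)/ϕ(x)` is increasing, which is a
-- Mills ratio inequality. Hence the copula decreases away from `p = q`
-- (`stdNormalCDF_mul_le_of_circle`, `binormal_le_diag`). Tail: with `L(x) = log C(eˣ, eˣ)`,
-- l'Hôpital's rule and `x Φ(x)/ϕ(x) → -1` give `L' → 2/(1+ρ)` at `-∞` (`tendsto_diag_logDeriv`). A
-- limit `κ` of `L'` makes the diagonal regularly varying of index `κ`, and all three indices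
-- follow: `κ` itself, `2/κ - 1`, and `0` because `κ > 1`.

local notation "Φ" => stdNormalCDF
local notation "ϕ" => gaussianPDFReal 0 1

/-! ### Standard normal density, distribution function and quantile -/

theorem hasDerivAt_setIntegral_Iic {g : ℝ → ℝ} (hg : Continuous g) (hi : Integrable g) (x : ℝ) :
    HasDerivAt (fun x => ∫ t in Iic x, g t) (g x) x := by
  have h : (fun x => ∫ t in Iic x, g t) = fun x => (∫ t in Iic 0, g t) + ∫ t in (0 : ℝ)..x, g t := by
    funext x
    rw [← intervalIntegral.integral_Iic_sub_Iic hi.integrableOn hi.integrableOn]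
    ring
  rw [h]
  exact (intervalIntegral.integral_hasDerivAt_right (hg.intervalIntegrable _ _)
    (hg.stronglyMeasurableAtFilter _ _) hg.continuousAt).const_add _

theorem stdNormalPDF_eq (x : ℝ) : ϕ x = (Real.sqrt (2 * Real.pi))⁻¹ * Real.exp (-(x ^ 2 / 2)) := by
  simp [gaussianPDFReal, neg_div]

theorem stdNormalPDF_pos (x : ℝ) : 0 < ϕ x := gaussianPDFReal_pos 0 1 x one_ne_zero

theorem continuous_stdNormalPDF : Continuous ϕ := by
  unfold gaussianPDFReal
  fun_prop

theorem hasDerivAt_stdNormalPDF (x : ℝ) : HasDerivAt ϕ (-x * ϕ x) x := by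
  have h : ϕ = fun x => (Real.sqrt (2 * Real.pi))⁻¹ * Real.exp (-(x ^ 2 / 2)) :=
    funext stdNormalPDF_eq
  rw [h]
  convert! ((((hasDerivAt_id x).pow 2).div_const 2).neg.exp).const_mul
    (Real.sqrt (2 * Real.pi))⁻¹ using 1
  simp
  ring

theorem stdNormalCDF_eq_integral (x : ℝ) : Φ x = ∫ t in Iic x, ϕ t := by
  rw [stdNormalCDF, cdf_eq_real, measureReal_def,
    gaussianReal_apply_eq_integral 0 one_ne_zero, ENNReal.toReal_ofReal]
  exact integral_nonneg fun t => gaussianPDFReal_nonneg 0 1 t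

theorem hasDerivAt_stdNormalCDF (x : ℝ) : HasDerivAt Φ (ϕ x) x := by
  rw [show Φ = fun x => ∫ t in Iic x, ϕ t from funext stdNormalCDF_eq_integral]
  exact hasDerivAt_setIntegral_Iic continuous_stdNormalPDF (integrable_gaussianPDFReal 0 1) x

theorem continuous_stdNormalCDF : Continuous Φ :=
  continuous_iff_continuousAt.2 fun x => (hasDerivAt_stdNormalCDF x).continuousAt

theorem tendsto_stdNormalCDF_atBot : Tendsto Φ atBot (𝓝 0) := tendsto_cdf_atBot _

theorem tendsto_stdNormalCDF_atTop : Tendsto Φ atTop (𝓝 1) := tendsto_cdf_atTop _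

theorem strictMono_stdNormalCDF : StrictMono Φ :=
  strictMono_of_hasDerivAt_pos hasDerivAt_stdNormalCDF stdNormalPDF_pos

theorem stdNormalCDF_nonneg (x : ℝ) : 0 ≤ Φ x := cdf_nonneg _ x

theorem stdNormalCDF_le_one (x : ℝ) : Φ x ≤ 1 := cdf_le_one _ x

theorem stdNormalCDF_pos (x : ℝ) : 0 < Φ x :=
  (stdNormalCDF_nonneg (x - 1)).trans_lt (strictMono_stdNormalCDF (by linarith))

theorem stdNormalCDF_lt_one (x : ℝ) : Φ x < 1 :=
  (strictMono_stdNormalCDF (by linarith : x < x + 1)).trans_le (stdNormalCDF_le_one _)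

theorem exists_stdNormalCDF_eq {p : ℝ} (hp : p ∈ Ioo (0 : ℝ) 1) : ∃ x, Φ x = p :=
  mem_range_of_exists_le_of_exists_ge continuous_stdNormalCDF
    ((tendsto_stdNormalCDF_atBot.eventually_le_const hp.1).exists)
    ((tendsto_stdNormalCDF_atTop.eventually_const_le hp.2).exists)

theorem stdNormalQuantile_stdNormalCDF (x : ℝ) : stdNormalQuantile (Φ x) = x := by
  refine IsLeast.csInf_eq ⟨⟨x, le_refl (Φ x), rfl⟩, ?_⟩
  rintro _ ⟨y, hy, rfl⟩
  exact EReal.coe_le_coe_iff.2 (strictMono_stdNormalCDF.le_iff_le.1 hy)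

theorem stdNormalQuantile_one : stdNormalQuantile 1 = ⊤ := by
  have : {x : ℝ | 1 ≤ Φ x} = ∅ := by
    ext x
    simpa using stdNormalCDF_lt_one x
  simp [stdNormalQuantile, this]

/-- The real-valued quantile function of the standard normal distribution. -/
noncomputable def realQuantile (p : ℝ) : ℝ := (stdNormalQuantile p).toReal

theorem realQuantile_stdNormalCDF (x : ℝ) : realQuantile (Φ x) = x := by
  simp [realQuantile, stdNormalQuantile_stdNormalCDF]

theorem stdNormalCDF_realQuantile {p : ℝ} (hp : p ∈ Ioo (0 : ℝ) 1) : Φ (realQuantile p) = p := by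
  obtain ⟨x, rfl⟩ := exists_stdNormalCDF_eq hp
  rw [realQuantile_stdNormalCDF]

theorem stdNormalQuantile_eq_coe {p : ℝ} (hp : p ∈ Ioo (0 : ℝ) 1) :
    stdNormalQuantile p = realQuantile p := by
  obtain ⟨x, rfl⟩ := exists_stdNormalCDF_eq hp
  rw [realQuantile_stdNormalCDF, stdNormalQuantile_stdNormalCDF]

theorem hasDerivAt_realQuantile {p : ℝ} (hp : p ∈ Ioo (0 : ℝ) 1) :
    HasDerivAt realQuantile (ϕ (realQuantile p))⁻¹ p := by
  obtain ⟨x, rfl⟩ := exists_stdNormalCDF_eq hp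
  rw [realQuantile_stdNormalCDF]
  have h : HasStrictDerivAt Φ (ϕ x) x :=
    hasStrictDerivAt_of_hasDerivAt_of_continuousAt (.of_forall hasDerivAt_stdNormalCDF)
      continuous_stdNormalPDF.continuousAt
  exact (h.to_local_left_inverse (stdNormalPDF_pos x).ne'
    (.of_forall realQuantile_stdNormalCDF)).hasDerivAt

theorem realQuantile_le_realQuantile {p q : ℝ} (hp : p ∈ Ioo (0 : ℝ) 1) (hq : q ∈ Ioo (0 : ℝ) 1)
    (h : p ≤ q) : realQuantile p ≤ realQuantile q := by
  rw [← strictMono_stdNormalCDF.le_iff_le, stdNormalCDF_realQuantile hp,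
    stdNormalCDF_realQuantile hq]
  exact h

theorem tendsto_realQuantile_exp_atBot :
    Tendsto (fun x => realQuantile (Real.exp x)) atBot atBot := by
  rw [tendsto_atBot]
  intro b
  filter_upwards [Real.tendsto_exp_atBot.eventually_le_const (stdNormalCDF_pos b),
    eventually_lt_atBot 0] with x hx hx0
  rw [← strictMono_stdNormalCDF.le_iff_le,
    stdNormalCDF_realQuantile ⟨Real.exp_pos x, Real.exp_zero ▸ Real.exp_lt_exp.2 hx0⟩]
  exact hx

/-! ### Mills ratio bounds -/

/-- A differentiable function with nonnegative derivative and limit `0` at `-∞` is nonnegative. -/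
theorem nonneg_of_hasDerivAt_nonneg_of_tendsto {g g' : ℝ → ℝ} (hg : ∀ x, HasDerivAt g (g' x) x)
    (hg' : ∀ x, 0 ≤ g' x) (h0 : Tendsto g atBot (𝓝 0)) (x : ℝ) : 0 ≤ g x :=
  (monotone_of_hasDerivAt_nonneg hg hg').le_of_tendsto h0 x

/-- Amounts to `(x+1)² ≥ 0`. This majorant is its own derivative, so it also bounds `Φ`, and it
beats every power at `-∞`; that supplies the limits behind the Mills bounds. -/
theorem stdNormalPDF_le_exp (x : ℝ) : ϕ x ≤ Real.exp (x + 1 / 2) := by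
  rw [stdNormalPDF_eq]
  have h1 : (Real.sqrt (2 * Real.pi))⁻¹ ≤ 1 := by
    apply inv_le_one_of_one_le₀
    rw [Real.one_le_sqrt]
    linarith [Real.pi_gt_three]
  have h2 : Real.exp (-(x ^ 2 / 2)) ≤ Real.exp (x + 1 / 2) :=
    Real.exp_le_exp.2 (by nlinarith [sq_nonneg (x + 1)])
  calc _ ≤ 1 * Real.exp (x + 1 / 2) := by gcongr
    _ = _ := one_mul _

theorem tendsto_exp_add_const_atBot : Tendsto (fun x : ℝ => Real.exp (x + 1 / 2)) atBot (𝓝 0) :=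
  Real.tendsto_exp_atBot.comp (tendsto_atBot_add_const_right _ _ tendsto_id)

theorem stdNormalCDF_le_exp (x : ℝ) : Φ x ≤ Real.exp (x + 1 / 2) := by
  have h := nonneg_of_hasDerivAt_nonneg_of_tendsto
    (g := fun x => Real.exp (x + 1 / 2) - Φ x) (g' := fun x => Real.exp (x + 1 / 2) - ϕ x)
    (fun x => by
      convert! (((hasDerivAt_id x).add_const (1 / 2)).exp).sub (hasDerivAt_stdNormalCDF x) using 1
      simp)
    (fun x => sub_nonneg.2 (stdNormalPDF_le_exp x))
    (by simpa using tendsto_exp_add_const_atBot.sub tendsto_stdNormalCDF_atBot) x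
  exact sub_nonneg.1 h

theorem tendsto_pow_mul_exp_add_const_atBot (n : ℕ) :
    Tendsto (fun x : ℝ => |x| ^ n * Real.exp (x + 1 / 2)) atBot (𝓝 0) := by
  have h := ((Real.tendsto_pow_mul_exp_neg_atTop_nhds_zero n).comp tendsto_neg_atBot_atTop).mul_const
    (Real.exp (1 / 2))
  rw [zero_mul] at h
  refine h.congr' ?_
  filter_upwards [eventually_le_atBot 0] with x hx
  simp only [Function.comp_apply, neg_neg, abs_of_nonpos hx, Real.exp_add]
  ring

theorem tendsto_pow_mul_zero_of_le_exp {g : ℝ → ℝ} (h0 : ∀ x, 0 ≤ g x)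
    (h : ∀ x, g x ≤ Real.exp (x + 1 / 2)) (n : ℕ) :
    Tendsto (fun x => x ^ n * g x) atBot (𝓝 0) := by
  refine squeeze_zero_norm (fun x => ?_) (tendsto_pow_mul_exp_add_const_atBot n)
  rw [norm_mul, norm_pow, Real.norm_eq_abs, Real.norm_eq_abs, abs_of_nonneg (h0 x)]
  gcongr
  exact h x

theorem tendsto_pow_mul_stdNormalCDF (n : ℕ) : Tendsto (fun x => x ^ n * Φ x) atBot (𝓝 0) :=
  tendsto_pow_mul_zero_of_le_exp stdNormalCDF_nonneg stdNormalCDF_le_exp n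

theorem tendsto_pow_mul_stdNormalPDF (n : ℕ) : Tendsto (fun x => x ^ n * ϕ x) atBot (𝓝 0) :=
  tendsto_pow_mul_zero_of_le_exp (fun x => (stdNormalPDF_pos x).le) stdNormalPDF_le_exp n

/-- The derivative of the left-out expression `x Φ(x) + ϕ(x)` is `Φ(x)`, by `ϕ' = -x ϕ`. -/
theorem mul_stdNormalCDF_add_nonneg (x : ℝ) : 0 ≤ x * Φ x + ϕ x := by
  refine nonneg_of_hasDerivAt_nonneg_of_tendsto (g := fun x => x * Φ x + ϕ x) (g' := Φ)
    (fun x => ?_) stdNormalCDF_nonneg ?_ x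
  · convert! ((hasDerivAt_id x).mul (hasDerivAt_stdNormalCDF x)).add (hasDerivAt_stdNormalPDF x)
      using 1
    simp
  · simpa using (tendsto_pow_mul_stdNormalCDF 1).add (tendsto_pow_mul_stdNormalPDF 0)

/-- The derivative is twice the expression of the previous bound. This quantity is the numerator of
the derivative of `x Φ(x)/ϕ(x)`. -/
theorem one_add_sq_mul_stdNormalCDF_add_nonneg (x : ℝ) : 0 ≤ (1 + x ^ 2) * Φ x + x * ϕ x := by
  refine nonneg_of_hasDerivAt_nonneg_of_tendsto (g := fun x => (1 + x ^ 2) * Φ x + x * ϕ x)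
    (g' := fun x => 2 * (x * Φ x + ϕ x)) (fun x => ?_)
    (fun x => mul_nonneg two_pos.le (mul_stdNormalCDF_add_nonneg x)) ?_ x
  · convert! ((((hasDerivAt_id x).pow 2).const_add 1).mul (hasDerivAt_stdNormalCDF x)).add
      ((hasDerivAt_id x).mul (hasDerivAt_stdNormalPDF x)) using 1
    simp
    ring
  · have := ((tendsto_pow_mul_stdNormalCDF 0).add (tendsto_pow_mul_stdNormalCDF 2)).add
      (tendsto_pow_mul_stdNormalPDF 1)
    simp only [pow_zero, pow_one, add_zero, ← add_mul] at this
    exact this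

theorem hasDerivAt_mul_mills (x : ℝ) :
    HasDerivAt (fun x => x * (Φ x / ϕ x)) (((1 + x ^ 2) * Φ x + x * ϕ x) / ϕ x) x := by
  have hp := (stdNormalPDF_pos x).ne'
  convert! (hasDerivAt_id x).mul ((hasDerivAt_stdNormalCDF x).div (hasDerivAt_stdNormalPDF x) hp)
    using 1
  simp only [id, Pi.div_apply]
  field_simp
  ring

theorem monotone_mul_mills : Monotone fun x => x * (Φ x / ϕ x) :=
  monotone_of_hasDerivAt_nonneg hasDerivAt_mul_mills fun x =>
    div_nonneg (one_add_sq_mul_stdNormalCDF_add_nonneg x) (stdNormalPDF_pos x).le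

/-- For `x < 0` the two Mills bounds squeeze the function between `-1` and `(1+x²)⁻¹ - 1`. -/
theorem tendsto_mul_mills : Tendsto (fun x => x * (Φ x / ϕ x)) atBot (𝓝 (-1)) := by
  have hlim : Tendsto (fun x : ℝ => (1 + x ^ 2)⁻¹ - 1) atBot (𝓝 (-1)) := by
    have : Tendsto (fun x : ℝ => 1 + x ^ 2) atBot atTop :=
      tendsto_atTop_add_const_left _ _ (by simpa [sq] using tendsto_id.atBot_mul_atBot₀ (tendsto_id (α := ℝ)))
    simpa using this.inv_tendsto_atTop.sub_const 1
  refine tendsto_of_tendsto_of_tendsto_of_le_of_le' tendsto_const_nhds hlim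
    (.of_forall fun x => ?_) ?_
  · have hp := stdNormalPDF_pos x
    have := mul_stdNormalCDF_add_nonneg x
    rw [← mul_div_assoc, le_div_iff₀ hp]
    linarith
  · filter_upwards [eventually_lt_atBot 0] with x hx
    have hp := stdNormalPDF_pos x
    have h := one_add_sq_mul_stdNormalCDF_add_nonneg x
    have h1 : 0 < 1 + x ^ 2 := by positivity
    rw [← mul_div_assoc, div_le_iff₀ hp,
      show (1 + x ^ 2)⁻¹ - 1 = -(x ^ 2) / (1 + x ^ 2) by field_simp; ring, div_mul_eq_mul_div,
      le_div_iff₀ h1]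
    nlinarith

/-- The product `Φ x * Φ y` grows along circles in the direction of the diagonal. -/
theorem stdNormalCDF_mul_le_of_circle {x y x' y' : ℝ} (hR : x ^ 2 + y ^ 2 = x' ^ 2 + y' ^ 2)
    (h : x + y ≤ x' + y') : Φ x * Φ y ≤ Φ x' * Φ y' := by
  wlog hxy : y ≤ x generalizing x y
  · rw [mul_comm (Φ x)]
    exact this (by linarith) (by linarith) (by linarith)
  wlog hxy' : y' ≤ x' generalizing x' y'
  · rw [mul_comm (Φ x')]
    exact this (by linarith) (by linarith) (by linarith)
  set K : ℝ := Real.sqrt ((x ^ 2 + y ^ 2) / 2) with hK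
  have hK2 : K ^ 2 = (x ^ 2 + y ^ 2) / 2 := Real.sq_sqrt (by positivity)
  have hK0 : 0 ≤ K := Real.sqrt_nonneg _
  rcases hK0.eq_or_lt with h0 | hKpos
  · rw [← h0] at hK2
    have e1 : x = 0 := by nlinarith [sq_nonneg x, sq_nonneg y]
    have e2 : y = 0 := by nlinarith [sq_nonneg x, sq_nonneg y]
    have e3 : x' = 0 := by nlinarith [sq_nonneg x', sq_nonneg y']
    have e4 : y' = 0 := by nlinarith [sq_nonneg x', sq_nonneg y']
    rw [e1, e2, e3, e4]
  -- Angular parameter on the circle of radius `√2 K`, on the side `b ≤ a`: the sum of the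
  -- coordinates is `2K sin θ`, their difference `2K cos θ`, so a larger sum means a larger `θ`.
  let Q : ℝ → ℝ := fun θ =>
    Φ (K * (Real.sin θ + Real.cos θ)) * Φ (K * (Real.sin θ - Real.cos θ))
  have key : ∀ a b : ℝ, b ≤ a → a ^ 2 + b ^ 2 = 2 * K ^ 2 →
      Φ a * Φ b = Q (Real.arcsin ((a + b) / (2 * K))) := by
    intro a b hab hsq
    have hs : Real.sin (Real.arcsin ((a + b) / (2 * K))) = (a + b) / (2 * K) := by
      apply Real.sin_arcsin
      · rw [le_div_iff₀ (by positivity)]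
        nlinarith [sq_nonneg (a - b), abs_le_of_sq_le_sq' (a := a + b) (b := 2 * K)
          (by nlinarith [sq_nonneg (a - b)]) (by positivity)]
      · rw [div_le_iff₀ (by positivity)]
        nlinarith [sq_nonneg (a - b), abs_le_of_sq_le_sq' (a := a + b) (b := 2 * K)
          (by nlinarith [sq_nonneg (a - b)]) (by positivity)]
    have hc : Real.cos (Real.arcsin ((a + b) / (2 * K))) = (a - b) / (2 * K) := by
      rw [Real.cos_arcsin, ← Real.sqrt_sq (by have := sub_nonneg.2 hab; positivity :
        0 ≤ (a - b) / (2 * K))]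
      congr 1
      field_simp
      linarith
    simp only [Q, hs, hc]
    congr 2 <;> field_simp <;> ring
  have hmono : MonotoneOn Q (Icc (-(Real.pi / 2)) (Real.pi / 2)) := by
    have hd : ∀ θ, HasDerivAt Q
        (ϕ (K * (Real.sin θ + Real.cos θ)) * (K * (Real.cos θ - Real.sin θ)) *
            Φ (K * (Real.sin θ - Real.cos θ)) +
          Φ (K * (Real.sin θ + Real.cos θ)) *
            (ϕ (K * (Real.sin θ - Real.cos θ)) * (K * (Real.cos θ + Real.sin θ)))) θ := by
      intro θ
      have h1 : HasDerivAt (fun θ => K * (Real.sin θ + Real.cos θ))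
          (K * (Real.cos θ - Real.sin θ)) θ := by
        simpa [sub_eq_add_neg] using
          ((Real.hasDerivAt_sin θ).add (Real.hasDerivAt_cos θ)).const_mul K
      have h2 : HasDerivAt (fun θ => K * (Real.sin θ - Real.cos θ))
          (K * (Real.cos θ + Real.sin θ)) θ := by
        simpa [sub_eq_add_neg] using
          ((Real.hasDerivAt_sin θ).sub (Real.hasDerivAt_cos θ)).const_mul K
      exact ((hasDerivAt_stdNormalCDF _).comp θ h1).mul ((hasDerivAt_stdNormalCDF _).comp θ h2)
    refine monotoneOn_of_hasDerivWithinAt_nonneg (convex_Icc _ _)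
      (fun θ _ => (hd θ).continuousAt.continuousWithinAt)
      (fun θ _ => (hd θ).hasDerivWithinAt) fun θ hθ => ?_
    rw [interior_Icc] at hθ
    have hcos := Real.cos_pos_of_mem_Ioo hθ
    -- With `a = K(sin θ + cos θ)` and `b = K(sin θ - cos θ)`, the derivative of `Q` is `a Φ(a) ϕ(b)
    -- - b Φ(b) ϕ(a)`, and `b ≤ a` because `cos θ > 0`.
    have hm := monotone_mul_mills (show K * (Real.sin θ - Real.cos θ) ≤
      K * (Real.sin θ + Real.cos θ) by gcongr; linarith)
    simp only at hm
    rw [← mul_div_assoc, ← mul_div_assoc,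
      div_le_div_iff₀ (stdNormalPDF_pos _) (stdNormalPDF_pos _)] at hm
    linarith
  rw [key x y hxy (by linarith), key x' y' hxy' (by linarith)]
  refine hmono (Real.arcsin_mem_Icc _) (Real.arcsin_mem_Icc _) (Real.monotone_arcsin ?_)
  gcongr

/-! ### The bivariate normal distribution function -/

/-- The bivariate normal distribution function at real arguments, with the inner integral
evaluated. -/
noncomputable def binormal (ρ s t : ℝ) : ℝ :=
  ∫ x in Iic s, ϕ x * Φ ((t - ρ * x) / Real.sqrt (1 - ρ ^ 2))

theorem sqrt_one_sub_sq_pos {ρ : ℝ} (hρ : ρ ∈ Ico (0 : ℝ) 1) : 0 < Real.sqrt (1 - ρ ^ 2) :=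
  Real.sqrt_pos.2 (by nlinarith [hρ.1, hρ.2])

theorem sq_sqrt_one_sub_sq {ρ : ℝ} (hρ : ρ ∈ Ico (0 : ℝ) 1) :
    Real.sqrt (1 - ρ ^ 2) ^ 2 = 1 - ρ ^ 2 :=
  Real.sq_sqrt (by nlinarith [hρ.1, hρ.2])

/-- Disintegration: given the first coordinate `x`, the second is normal with mean `ρx` and variance
`1-ρ²`. -/
theorem binormalDensity_eq {ρ : ℝ} (hρ : ρ ∈ Ico (0 : ℝ) 1) (x y : ℝ) :
    binormalDensity ρ x y = ϕ x * ((Real.sqrt (1 - ρ ^ 2))⁻¹ *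
      ϕ ((y - ρ * x) / Real.sqrt (1 - ρ ^ 2))) := by
  have hr := sqrt_one_sub_sq_pos hρ
  have hr2 := sq_sqrt_one_sub_sq hρ
  have h1 : 1 - ρ ^ 2 ≠ 0 := by rw [← hr2]; positivity
  have h2 : Real.sqrt (2 * Real.pi) * Real.sqrt (2 * Real.pi) = 2 * Real.pi :=
    Real.mul_self_sqrt (by positivity)
  rw [binormalDensity, stdNormalPDF_eq, stdNormalPDF_eq, div_pow, hr2,
    show -((x ^ 2 - 2 * ρ * x * y + y ^ 2) / (2 * (1 - ρ ^ 2))) =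
      -(x ^ 2 / 2) + -((y - ρ * x) ^ 2 / (1 - ρ ^ 2) / 2) by field_simp; ring,
    Real.exp_add]
  generalize Real.sqrt (2 * Real.pi) = c at h2
  rw [← h2]
  field_simp

theorem binormalDensity_comm (ρ x y : ℝ) : binormalDensity ρ x y = binormalDensity ρ y x := by
  unfold binormalDensity
  ring_nf

theorem integral_Iic_comp_affine (g : ℝ → ℝ) {r : ℝ} (hr : 0 < r) (m t : ℝ) :
    ∫ y in Iic t, r⁻¹ * g ((y - m) / r) = ∫ y in Iic ((t - m) / r), g y := by
  rw [← integral_indicator measurableSet_Iic, ← integral_indicator measurableSet_Iic]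
  have h : ∀ y, (Iic t).indicator (fun y => r⁻¹ * g ((y - m) / r)) y =
      r⁻¹ * (Iic ((t - m) / r)).indicator g ((y - m) / r) := by
    intro y
    by_cases hy : y ≤ t
    · have : (y - m) / r ≤ (t - m) / r := by gcongr
      simp [indicator, hy, this]
    · have : ¬ (y - m) / r ≤ (t - m) / r := by
        rw [div_le_div_iff_of_pos_right hr]
        linarith
      simp [indicator, hy, this]
  simp_rw [h]
  rw [integral_const_mul, integral_sub_right_eq_self
    (fun y => (Iic ((t - m) / r)).indicator g (y / r)) m,
    Measure.integral_comp_div, abs_of_pos hr, smul_eq_mul, inv_mul_cancel_left₀ hr.ne']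

theorem integral_comp_affine (g : ℝ → ℝ) {r : ℝ} (hr : 0 < r) (m : ℝ) :
    ∫ y, r⁻¹ * g ((y - m) / r) = ∫ y, g y := by
  rw [integral_const_mul, integral_sub_right_eq_self (fun y => g (y / r)) m,
    Measure.integral_comp_div, abs_of_pos hr, smul_eq_mul, inv_mul_cancel_left₀ hr.ne']

theorem setIntegral_binormalDensity {ρ : ℝ} (hρ : ρ ∈ Ico (0 : ℝ) 1) (x t : ℝ) :
    ∫ y in Iic t, binormalDensity ρ x y =
      ϕ x * Φ ((t - ρ * x) / Real.sqrt (1 - ρ ^ 2)) := by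
  simp_rw [binormalDensity_eq hρ]
  rw [integral_const_mul, integral_Iic_comp_affine ϕ (sqrt_one_sub_sq_pos hρ),
    stdNormalCDF_eq_integral]

theorem integral_binormalDensity {ρ : ℝ} (hρ : ρ ∈ Ico (0 : ℝ) 1) (x : ℝ) :
    ∫ y, binormalDensity ρ x y = ϕ x := by
  simp_rw [binormalDensity_eq hρ]
  rw [integral_const_mul, integral_comp_affine ϕ (sqrt_one_sub_sq_pos hρ),
    integral_gaussianPDFReal_eq_one 0 one_ne_zero, mul_one]

theorem binormalDensity_nonneg (ρ x y : ℝ) : 0 ≤ binormalDensity ρ x y := by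
  unfold binormalDensity
  positivity

theorem integrable_binormalDensity {ρ : ℝ} (hρ : ρ ∈ Ico (0 : ℝ) 1) :
    Integrable (Function.uncurry (binormalDensity ρ)) (volume.prod volume) := by
  have hc : Continuous (Function.uncurry (binormalDensity ρ)) := by
    unfold binormalDensity Function.uncurry
    fun_prop
  refine (integrable_prod_iff hc.aestronglyMeasurable).2 ⟨.of_forall fun x => ?_, ?_⟩
  · simp only [Function.uncurry, binormalDensity_eq hρ]
    refine Integrable.const_mul (Integrable.const_mul ?_ _) _
    exact ((integrable_gaussianPDFReal 0 1).comp_div (sqrt_one_sub_sq_pos hρ).ne').comp_sub_right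
      (ρ * x)
  · simp only [Function.uncurry, Real.norm_of_nonneg (binormalDensity_nonneg ρ _ _),
      integral_binormalDensity hρ]
    exact integrable_gaussianPDFReal 0 1

theorem binormalCDF_comm {ρ : ℝ} (hρ : ρ ∈ Ico (0 : ℝ) 1) (s t : EReal) :
    binormalCDF ρ s t = binormalCDF ρ t s := by
  unfold binormalCDF
  rw [integral_integral_swap]
  · simp_rw [fun x y => binormalDensity_comm ρ x y]
  · rw [Measure.prod_restrict]
    exact (integrable_binormalDensity hρ).restrict

theorem binormalCDF_coe_coe {ρ : ℝ} (hρ : ρ ∈ Ico (0 : ℝ) 1) (s t : ℝ) :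
    binormalCDF ρ s t = binormal ρ s t := by
  simp only [binormalCDF, EReal.coe_le_coe_iff]
  exact integral_congr_ae (.of_forall fun x => setIntegral_binormalDensity hρ x t)

theorem binormal_comm {ρ : ℝ} (hρ : ρ ∈ Ico (0 : ℝ) 1) (s t : ℝ) :
    binormal ρ s t = binormal ρ t s := by
  rw [← binormalCDF_coe_coe hρ, binormalCDF_comm hρ, binormalCDF_coe_coe hρ]

theorem binormalCDF_coe_top {ρ : ℝ} (hρ : ρ ∈ Ico (0 : ℝ) 1) (s : ℝ) :
    binormalCDF ρ s ⊤ = Φ s := by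
  simp only [binormalCDF, EReal.coe_le_coe_iff, le_top, ofPred_true, Measure.restrict_univ,
    integral_binormalDensity hρ]
  exact (stdNormalCDF_eq_integral s).symm

theorem continuous_binormal_integrand (ρ t : ℝ) :
    Continuous fun x => ϕ x * Φ ((t - ρ * x) / Real.sqrt (1 - ρ ^ 2)) :=
  continuous_stdNormalPDF.mul (continuous_stdNormalCDF.comp (by fun_prop))

theorem binormal_integrand_nonneg (ρ t x : ℝ) :
    0 ≤ ϕ x * Φ ((t - ρ * x) / Real.sqrt (1 - ρ ^ 2)) :=
  mul_nonneg (stdNormalPDF_pos x).le (stdNormalCDF_nonneg _)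

theorem binormal_integrand_le (ρ t x : ℝ) :
    ϕ x * Φ ((t - ρ * x) / Real.sqrt (1 - ρ ^ 2)) ≤ ϕ x :=
  mul_le_of_le_one_right (stdNormalPDF_pos x).le (stdNormalCDF_le_one _)

theorem integrable_binormal_integrand (ρ t : ℝ) :
    Integrable fun x => ϕ x * Φ ((t - ρ * x) / Real.sqrt (1 - ρ ^ 2)) :=
  (integrable_gaussianPDFReal 0 1).mono' (continuous_binormal_integrand ρ t).aestronglyMeasurable
    (.of_forall fun x => by
      rw [Real.norm_of_nonneg (binormal_integrand_nonneg ρ t x)]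
      exact binormal_integrand_le ρ t x)

theorem binormal_nonneg (ρ s t : ℝ) : 0 ≤ binormal ρ s t :=
  integral_nonneg fun x => binormal_integrand_nonneg ρ t x

theorem binormal_le (ρ s t : ℝ) : binormal ρ s t ≤ Φ s := by
  rw [stdNormalCDF_eq_integral]
  exact integral_mono (integrable_binormal_integrand ρ t).integrableOn
    (integrable_gaussianPDFReal 0 1).integrableOn fun x => binormal_integrand_le ρ t x

/-- The lower Fréchet bound. -/
theorem le_binormal {ρ : ℝ} (hρ : ρ ∈ Ico (0 : ℝ) 1) (s t : ℝ) :
    Φ s + Φ t - 1 ≤ binormal ρ s t := by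
  have h1 : ∫ x, ϕ x * Φ ((t - ρ * x) / Real.sqrt (1 - ρ ^ 2)) = Φ t := by
    rw [← binormalCDF_coe_top hρ, binormalCDF_comm hρ]
    simp only [binormalCDF, EReal.coe_le_coe_iff, le_top, ofPred_true, Measure.restrict_univ]
    exact integral_congr_ae (.of_forall fun x => (setIntegral_binormalDensity hρ x t).symm)
  have h2 : ∫ x, ϕ x = 1 := integral_gaussianPDFReal_eq_one 0 one_ne_zero
  have h3 := integral_add_compl (measurableSet_Iic (a := s)) (integrable_binormal_integrand ρ t)
  have h4 := integral_add_compl (measurableSet_Iic (a := s)) (integrable_gaussianPDFReal 0 1)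
  -- The mass of `X > s, Y ≤ t` is at most that of `X > s`, which is `1 - Φ s`.
  have h5 : ∫ x in (Iic s)ᶜ, ϕ x * Φ ((t - ρ * x) / Real.sqrt (1 - ρ ^ 2)) ≤
      ∫ x in (Iic s)ᶜ, ϕ x :=
    integral_mono (integrable_binormal_integrand ρ t).integrableOn
      (integrable_gaussianPDFReal 0 1).integrableOn fun x => binormal_integrand_le ρ t x
  rw [← stdNormalCDF_eq_integral] at h4
  unfold binormal
  linarith

theorem hasDerivAt_binormal_left (ρ s t : ℝ) :
    HasDerivAt (fun s => binormal ρ s t) (ϕ s * Φ ((t - ρ * s) / Real.sqrt (1 - ρ ^ 2))) s :=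
  hasDerivAt_setIntegral_Iic (continuous_binormal_integrand ρ t)
    (integrable_binormal_integrand ρ t) s

theorem hasDerivAt_binormal_right {ρ : ℝ} (hρ : ρ ∈ Ico (0 : ℝ) 1) (s t : ℝ) :
    HasDerivAt (fun t => binormal ρ s t) (ϕ t * Φ ((s - ρ * t) / Real.sqrt (1 - ρ ^ 2))) t := by
  simp_rw [binormal_comm hρ s]
  exact hasDerivAt_binormal_left ρ t s

/-- Both partial derivatives exist everywhere and are continuous, so `binormal ρ` is strictly
differentiable and the chain rule applies. -/
theorem hasDerivAt_binormal_comp {ρ : ℝ} (hρ : ρ ∈ Ico (0 : ℝ) 1) {s t : ℝ → ℝ} {s' t' x : ℝ}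
    (hs : HasDerivAt s s' x) (ht : HasDerivAt t t' x) :
    HasDerivAt (fun x => binormal ρ (s x) (t x))
      (ϕ (s x) * Φ ((t x - ρ * s x) / Real.sqrt (1 - ρ ^ 2)) * s' +
        ϕ (t x) * Φ ((s x - ρ * t x) / Real.sqrt (1 - ρ ^ 2)) * t') x := by
  have h := hasStrictFDerivAt_uncurry_coprod (𝕜 := ℝ) (u := (s x, t x)) (f := binormal ρ)
    (f₁ := fun s t => ContinuousLinearMap.toSpanSingleton ℝ
      (ϕ s * Φ ((t - ρ * s) / Real.sqrt (1 - ρ ^ 2))))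
    (f₂ := fun s t => ContinuousLinearMap.toSpanSingleton ℝ
      (ϕ t * Φ ((s - ρ * t) / Real.sqrt (1 - ρ ^ 2))))
    (.of_forall fun v => (hasDerivAt_binormal_left ρ v.1 v.2).hasFDerivAt)
    (.of_forall fun v => (hasDerivAt_binormal_right hρ v.1 v.2).hasFDerivAt)
    (Continuous.continuousAt ((ContinuousLinearMap.toSpanSingletonCLE (𝕜 := ℝ)).continuous.comp
      ((continuous_stdNormalPDF.comp continuous_fst).mul
        (continuous_stdNormalCDF.comp (by fun_prop)))))
    (Continuous.continuousAt ((ContinuousLinearMap.toSpanSingletonCLE (𝕜 := ℝ)).continuous.comp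
      ((continuous_stdNormalPDF.comp continuous_snd).mul
        (continuous_stdNormalCDF.comp (by fun_prop)))))
  have h2 := h.hasFDerivAt.comp_hasDerivAt x (hs.prodMk ht)
  convert! h2 using 1
  simp [Function.HasUncurry.uncurry]
  ring

/-! ### The diagonal is a path of maximal dependence -/

theorem gaussianCopula_eq {ρ : ℝ} (hρ : ρ ∈ Ico (0 : ℝ) 1) {u v : ℝ} (hu : u ∈ Ioo (0 : ℝ) 1)
    (hv : v ∈ Ioo (0 : ℝ) 1) :
    gaussianCopula ρ u v = binormal ρ (realQuantile u) (realQuantile v) := by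
  rw [gaussianCopula, stdNormalQuantile_eq_coe hu, stdNormalQuantile_eq_coe hv,
    binormalCDF_coe_coe hρ]

theorem gaussianCopula_comm {ρ : ℝ} (hρ : ρ ∈ Ico (0 : ℝ) 1) (u v : ℝ) :
    gaussianCopula ρ u v = gaussianCopula ρ v u :=
  binormalCDF_comm hρ _ _

theorem gaussianCopula_one_right {ρ : ℝ} (hρ : ρ ∈ Ico (0 : ℝ) 1) {u : ℝ}
    (hu : u ∈ Ioo (0 : ℝ) 1) : gaussianCopula ρ u 1 = u := by
  rw [gaussianCopula, stdNormalQuantile_eq_coe hu, stdNormalQuantile_one, binormalCDF_coe_top hρ,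
    stdNormalCDF_realQuantile hu]

/-- Both pairs have squared norm `(s² - 2ρst + t²)/(1-ρ²)`, and their coordinate sums differ by
`(s-t)((1+ρ)/r - 1)`, where `r ≤ 1 ≤ 1+ρ`. -/
theorem stdNormalCDF_mul_conditional_le {ρ : ℝ} (hρ : ρ ∈ Ico (0 : ℝ) 1) {s t : ℝ} (h : t ≤ s) :
    Φ s * Φ ((t - ρ * s) / Real.sqrt (1 - ρ ^ 2)) ≤
      Φ t * Φ ((s - ρ * t) / Real.sqrt (1 - ρ ^ 2)) := by
  have hr := sqrt_one_sub_sq_pos hρ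
  have hr2 := sq_sqrt_one_sub_sq hρ
  set r := Real.sqrt (1 - ρ ^ 2)
  have hr1 : r ≤ 1 := by nlinarith [sq_nonneg ρ]
  apply stdNormalCDF_mul_le_of_circle
  · field_simp
    rw [hr2]
    ring
  · have h1 : (s - ρ * t) / r - (t - ρ * s) / r = (s - t) * ((1 + ρ) / r) := by ring
    have h2 : 1 ≤ (1 + ρ) / r := by
      rw [le_div_iff₀ hr]
      linarith [hρ.1]
    nlinarith [sub_nonneg.2 h]

theorem binormal_le_diag {ρ : ℝ} (hρ : ρ ∈ Ico (0 : ℝ) 1) {u p q : ℝ} (hu : u ∈ Ioo (0 : ℝ) 1)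
    (hp : p ∈ Ioo (0 : ℝ) 1) (hq : q ∈ Ioo (0 : ℝ) 1) (hpq : p * q = u ^ 2) :
    binormal ρ (realQuantile p) (realQuantile q) ≤
      binormal ρ (realQuantile u) (realQuantile u) := by
  wlog hle : q ≤ p generalizing p q
  · rw [binormal_comm hρ]
    exact this hq hp (by linarith) (by linarith)
  have hu0 := hu.1
  have hp0 := hp.1
  have hup : u ≤ p := by nlinarith [hq.1]
  have hx0 : 0 ≤ Real.log (p / u) := Real.log_nonneg ((one_le_div hu0).2 hup)
  have hexp : u * Real.exp (Real.log (p / u)) = p := by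
    rw [Real.exp_log (by positivity)]
    field_simp
  have hexp' : u * Real.exp (-Real.log (p / u)) = q := by
    rw [Real.exp_neg, Real.exp_log (by positivity), inv_div, ← mul_div_assoc, ← sq, ← hpq]
    field_simp
  have hmem : ∀ x ∈ Icc 0 (Real.log (p / u)), u * Real.exp x ∈ Ioo (0 : ℝ) 1 ∧
      u * Real.exp (-x) ∈ Ioo (0 : ℝ) 1 := by
    intro x hx
    refine ⟨⟨by positivity, ?_⟩, by positivity, ?_⟩
    · refine lt_of_le_of_lt ?_ hp.2
      rw [← hexp]
      gcongr
      exact hx.2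
    · have : Real.exp (-x) ≤ 1 := Real.exp_le_one_iff.2 (by linarith [hx.1])
      nlinarith [hu.2]
  -- The derivative of the quantile contributes `1/ϕ`, which cancels the density in the partial
  -- derivative; the remaining factors `u e^{±x}` are `Φ` of the quantiles.
  have hd : ∀ x ∈ Icc 0 (Real.log (p / u)), HasDerivAt
      (fun x => binormal ρ (realQuantile (u * Real.exp x)) (realQuantile (u * Real.exp (-x))))
      (Φ (realQuantile (u * Real.exp x)) *
          Φ ((realQuantile (u * Real.exp (-x)) - ρ * realQuantile (u * Real.exp x)) /
            Real.sqrt (1 - ρ ^ 2)) -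
        Φ (realQuantile (u * Real.exp (-x))) *
          Φ ((realQuantile (u * Real.exp x) - ρ * realQuantile (u * Real.exp (-x))) /
            Real.sqrt (1 - ρ ^ 2))) x := by
    intro x hx
    obtain ⟨h1, h2⟩ := hmem x hx
    have d1 := (hasDerivAt_realQuantile h1).comp x ((Real.hasDerivAt_exp x).const_mul u)
    have d2 := (hasDerivAt_realQuantile h2).comp x ((hasDerivAt_neg x).exp.const_mul u)
    convert! hasDerivAt_binormal_comp hρ d1 d2 using 1
    simp only [Function.comp_apply]
    rw [stdNormalCDF_realQuantile h1, stdNormalCDF_realQuantile h2]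
    have e1 := (stdNormalPDF_pos (realQuantile (u * Real.exp x))).ne'
    have e2 := (stdNormalPDF_pos (realQuantile (u * Real.exp (-x)))).ne'
    field_simp
    ring
  have hanti := antitoneOn_of_hasDerivWithinAt_nonpos (convex_Icc 0 (Real.log (p / u)))
    (fun x hx => (hd x hx).continuousAt.continuousWithinAt)
    (fun x hx => (hd x (interior_subset hx)).hasDerivWithinAt) (fun x hx => by
      have hx' := interior_subset hx
      have hle : realQuantile (u * Real.exp (-x)) ≤ realQuantile (u * Real.exp x) := by
        refine realQuantile_le_realQuantile (hmem x hx').2 (hmem x hx').1 ?_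
        gcongr
        linarith [hx'.1]
      exact sub_nonpos.2 (stdNormalCDF_mul_conditional_le hρ hle))
  simpa [hexp, hexp'] using hanti (left_mem_Icc.2 hx0) (right_mem_Icc.2 hx0) hx0

/-- Covers the ends of the hyperbola, where one argument is `1` and its quantile infinite. The
Fréchet bound at interior points `(p, u²/p)` tends to `u²` as `p ↑ 1`. -/
theorem sq_le_binormal_diag {ρ : ℝ} (hρ : ρ ∈ Ico (0 : ℝ) 1) {u : ℝ} (hu : u ∈ Ioo (0 : ℝ) 1) :
    u ^ 2 ≤ binormal ρ (realQuantile u) (realQuantile u) := by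
  have hu2 : u ^ 2 < 1 := by nlinarith [hu.1, hu.2]
  have hlim : Tendsto (fun p : ℝ => p + u ^ 2 / p - 1) (𝓝[<] 1) (𝓝 (u ^ 2)) := by
    have : ContinuousAt (fun p : ℝ => p + u ^ 2 / p - 1) 1 := by fun_prop (disch := norm_num)
    simpa [ContinuousAt] using this.tendsto.mono_left (nhdsWithin_le_nhds (s := Iio 1))
  refine le_of_tendsto hlim ?_
  filter_upwards [Ioo_mem_nhdsLT hu2] with p hp
  have hu20 : 0 < u ^ 2 := pow_pos hu.1 2
  have hp0 : 0 < p := hu20.trans hp.1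
  have hp' : p ∈ Ioo (0 : ℝ) 1 := ⟨hp0, hp.2⟩
  have hq' : u ^ 2 / p ∈ Ioo (0 : ℝ) 1 := ⟨by positivity, (div_lt_one hp0).2 hp.1⟩
  have h1 := le_binormal hρ (realQuantile p) (realQuantile (u ^ 2 / p))
  rw [stdNormalCDF_realQuantile hp', stdNormalCDF_realQuantile hq'] at h1
  exact h1.trans (binormal_le_diag hρ hu hp' hq' (by field_simp))

theorem gaussianCopula_le_diag {ρ : ℝ} (hρ : ρ ∈ Ico (0 : ℝ) 1) {u p : ℝ}
    (hu : u ∈ Ioo (0 : ℝ) 1) (hp : p ∈ Icc (u ^ 2) 1) :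
    gaussianCopula ρ p (u ^ 2 / p) ≤ gaussianCopula ρ u u := by
  have hu2 : u ^ 2 < 1 := by nlinarith [hu.1, hu.2]
  have hu20 : 0 < u ^ 2 := pow_pos hu.1 2
  have hp0 : 0 < p := hu20.trans_le hp.1
  rw [gaussianCopula_eq hρ hu hu]
  rcases hp.2.eq_or_lt with rfl | hp1
  · rw [div_one, gaussianCopula_comm hρ, gaussianCopula_one_right hρ ⟨hu20, hu2⟩]
    exact sq_le_binormal_diag hρ hu
  rcases hp.1.eq_or_lt with rfl | hp2
  · rw [div_self hu20.ne', gaussianCopula_one_right hρ ⟨hu20, hu2⟩]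
    exact sq_le_binormal_diag hρ hu
  have hq : u ^ 2 / p ∈ Ioo (0 : ℝ) 1 := ⟨by positivity, (div_lt_one hp0).2 hp2⟩
  rw [gaussianCopula_eq hρ ⟨hp0, hp1⟩ hq]
  exact binormal_le_diag hρ hu ⟨hp0, hp1⟩ hq (by field_simp)

theorem isAdmissible_id : IsAdmissible id where
  mem_Icc u hu := ⟨by simp only [id]; nlinarith [hu.1, hu.2], hu.2⟩
  tendsto_fst := tendsto_id.mono_left nhdsWithin_le_nhds
  tendsto_snd := by
    refine (tendsto_id.mono_left nhdsWithin_le_nhds).congr fun u => ?_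
    -- At `u = 0` the identity `u²/u = u` relies on `0/0 = 0`.
    by_cases h : u = 0 <;> simp [h, sq]

theorem pathProb_id (C : ℝ → ℝ → ℝ) {u : ℝ} (hu : u ∈ Ioo (0 : ℝ) 1) :
    pathProb C id u = C u u := by
  simp [pathProb, sq, hu.1.ne']

theorem isMaxDependence_gaussianCopula_id {ρ : ℝ} (hρ : ρ ∈ Ico (0 : ℝ) 1) :
    IsMaxDependence (gaussianCopula ρ) id := by
  refine ⟨isAdmissible_id, fun u hu => ⟨⟨id, isAdmissible_id, rfl⟩, ?_⟩⟩
  rintro _ ⟨ψ, hψ, rfl⟩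
  rw [pathProb_id _ hu]
  exact gaussianCopula_le_diag hρ hu (hψ.mem_Icc u ⟨hu.1.le, hu.2.le⟩)

theorem IsMaxDependence.pathProb_eq {C : ℝ → ℝ → ℝ} {φ ψ : ℝ → ℝ} (hφ : IsMaxDependence C φ)
    (hψ : IsMaxDependence C ψ) {u : ℝ} (hu : u ∈ Ioo (0 : ℝ) 1) :
    pathProb C φ u = pathProb C ψ u :=
  (hφ.2 u hu).unique (hψ.2 u hu)

/-! ### Tail indices of functions with a logarithmic derivative -/

theorem HasLambda.congr {P Q : ℝ → ℝ} {l : ℝ} (h : HasLambda P l) (hPQ : P =ᶠ[𝓝[>] 0] Q) :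
    HasLambda Q l :=
  Tendsto.congr' (hPQ.mono fun u hu => by simp only [hu]) h

theorem HasChi.congr {P Q : ℝ → ℝ} {c : ℝ} (h : HasChi P c) (hPQ : P =ᶠ[𝓝[>] 0] Q) :
    HasChi Q c :=
  Tendsto.congr' (hPQ.mono fun u hu => by simp only [hu]) h

theorem SolvesTailEquation.congr {P Q : ℝ → ℝ} {k : ℝ} (h : SolvesTailEquation P k)
    (hPQ : P =ᶠ[𝓝[>] 0] Q) : SolvesTailEquation Q k := by
  obtain ⟨ℓ, hℓ, he⟩ := h
  exact ⟨ℓ, hℓ, (he.and hPQ).mono fun u hu => hu.2 ▸ hu.1⟩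

theorem HasKappa.congr {P Q : ℝ → ℝ} {k : ℝ} (h : HasKappa P k) (hPQ : P =ᶠ[𝓝[>] 0] Q) :
    HasKappa Q k :=
  ⟨h.1.congr hPQ, fun k' hk' => h.2 k' (hk'.congr hPQ.symm)⟩

/-- Mean value inequality for `L x - κ x`, whose derivative is eventually smaller than `ε`. It
controls both `L x / x` and the increments of `L`. -/
theorem abs_sub_sub_le_of_tendsto_deriv {L L' : ℝ → ℝ} {κ : ℝ}
    (hd : ∀ x < 0, HasDerivAt L (L' x) x) (hlim : Tendsto L' atBot (𝓝 κ)) {ε : ℝ} (hε : 0 < ε) :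
    ∃ X < 0, ∀ x ≤ X, ∀ y ≤ X, |(L x - κ * x) - (L y - κ * y)| ≤ ε * |x - y| := by
  obtain ⟨X, hX⟩ := eventually_atBot.1 ((Metric.tendsto_nhds.1 hlim ε hε).and
    (eventually_lt_atBot 0))
  refine ⟨X, (hX X le_rfl).2, fun x hx y hy => ?_⟩
  exact (convex_Iic X).norm_image_sub_le_of_norm_hasDerivWithin_le
    (f := fun x => L x - κ * x) (f' := fun x => L' x - κ)
    (fun z hz => by
      have h := ((hd z (hX z hz).2).sub ((hasDerivAt_id z).const_mul κ)).hasDerivWithinAt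
        (s := Iic X)
      rw [mul_one] at h
      exact h)
    (fun z hz => (hX z hz).1.le) hy hx

theorem tendsto_div_of_tendsto_deriv {L L' : ℝ → ℝ} {κ : ℝ}
    (hd : ∀ x < 0, HasDerivAt L (L' x) x) (hlim : Tendsto L' atBot (𝓝 κ)) :
    Tendsto (fun x => L x / x) atBot (𝓝 κ) := by
  have ho : (fun x => L x - κ * x) =o[atBot] (id : ℝ → ℝ) := by
    rw [Asymptotics.isLittleO_iff]
    intro c hc
    obtain ⟨X, hX0, hX⟩ := abs_sub_sub_le_of_tendsto_deriv hd hlim (half_pos hc)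
    filter_upwards [eventually_le_atBot X,
      eventually_le_atBot (-(|L X - κ * X| / (c / 2)))] with x hx hx2
    have h1 := hX x hx X le_rfl
    have h2 : |L X - κ * X| ≤ c / 2 * -x := by
      rw [← div_le_iff₀' (half_pos hc)]
      linarith
    rw [abs_of_nonpos (by linarith : x - X ≤ 0)] at h1
    rw [Real.norm_eq_abs, id, Real.norm_eq_abs, abs_of_neg (by linarith : x < 0)]
    have h3 := abs_sub_abs_le_abs_sub (L x - κ * x) (L X - κ * X)
    nlinarith
  have h := ho.tendsto_div_nhds_zero.add_const κ
  rw [zero_add] at h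
  refine h.congr' ?_
  filter_upwards [eventually_lt_atBot 0] with x hx
  simp only [id]
  field_simp [hx.ne]
  ring

theorem tendsto_add_sub_of_tendsto_deriv {L L' : ℝ → ℝ} {κ : ℝ}
    (hd : ∀ x < 0, HasDerivAt L (L' x) x) (hlim : Tendsto L' atBot (𝓝 κ)) (b : ℝ) :
    Tendsto (fun x => L (x + b) - L x) atBot (𝓝 (κ * b)) := by
  rw [Metric.tendsto_nhds]
  intro ε hε
  have hb : 0 < |b| + 1 := by positivity
  obtain ⟨X, -, hX⟩ := abs_sub_sub_le_of_tendsto_deriv hd hlim (div_pos hε hb)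
  filter_upwards [eventually_le_atBot X, eventually_le_atBot (X - b)] with x hx hxb
  have h := hX (x + b) (by linarith) x hx
  rw [Real.dist_eq]
  calc |L (x + b) - L x - κ * b| = |(L (x + b) - κ * (x + b)) - (L x - κ * x)| := by ring_nf
    _ ≤ ε / (|b| + 1) * |b| := by simpa using h
    _ < ε := by
      rw [div_mul_eq_mul_div, div_lt_iff₀ hb]
      nlinarith

theorem eventually_pos_smul {p : ℝ → Prop} (h : ∀ᶠ u in 𝓝[>] (0 : ℝ), p u) {c : ℝ} (hc : 0 < c) :
    ∀ᶠ u in 𝓝[>] (0 : ℝ), p (c * u) := by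
  have : Tendsto (fun u : ℝ => c * u) (𝓝[>] 0) (𝓝[>] 0) := by
    refine tendsto_nhdsWithin_iff.2 ⟨?_, ?_⟩
    · simpa using ((continuous_const_mul c).tendsto 0).mono_left nhdsWithin_le_nhds
    · filter_upwards [self_mem_nhdsWithin] with u hu using mul_pos hc hu
  exact this.eventually h

/-- Turns slow variation of `ℓ` into regular variation of `P`, for both existence and uniqueness of
the exponent. -/
theorem div_eventuallyEq_of_tailEquation {P ℓ : ℝ → ℝ} {k : ℝ}
    (h : ∀ᶠ u in 𝓝[>] (0 : ℝ), P u = ℓ u * u ^ k) {c : ℝ} (hc : 0 < c) :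
    (fun u => ℓ (c * u) / ℓ u) =ᶠ[𝓝[>] 0] fun u => P (c * u) / P u * c ^ (-k) := by
  filter_upwards [h, eventually_pos_smul h hc, self_mem_nhdsWithin] with u h1 h2 hu
  have hu : 0 < u := hu
  rw [h1, h2, Real.mul_rpow hc.le hu.le, Real.rpow_neg hc.le]
  have e1 := (Real.rpow_pos_of_pos hc k).ne'
  have e2 := (Real.rpow_pos_of_pos hu k).ne'
  field_simp

section TailIndices

variable {P L' : ℝ → ℝ} {κ : ℝ}

/-- In the variable `x = log u`, the ratio is the exponential of the increment of `log P(eˣ)` over a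
step `log c`. -/
theorem tendsto_mul_div_of_tendsto_logDeriv (hpos : ∀ u ∈ Ioo (0 : ℝ) 1, 0 < P u)
    (hd : ∀ x < 0, HasDerivAt (fun x => Real.log (P (Real.exp x))) (L' x) x)
    (hlim : Tendsto L' atBot (𝓝 κ)) {c : ℝ} (hc : 0 < c) :
    Tendsto (fun u => P (c * u) / P u) (𝓝[>] 0) (𝓝 (c ^ κ)) := by
  have h := (Real.continuous_exp.tendsto _).comp
    ((tendsto_add_sub_of_tendsto_deriv hd hlim (Real.log c)).comp Real.tendsto_log_nhdsGT_zero)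
  rw [mul_comm, ← Real.rpow_def_of_pos hc] at h
  have h01 : ∀ᶠ u in 𝓝[>] (0 : ℝ), u ∈ Ioo (0 : ℝ) 1 := Ioo_mem_nhdsGT one_pos
  refine h.congr' ?_
  filter_upwards [h01, eventually_pos_smul h01 hc] with u hu hcu
  simp only [Function.comp_apply]
  rw [Real.exp_add, Real.exp_log hu.1, Real.exp_log hc, mul_comm u, Real.exp_sub,
    Real.exp_log (hpos _ hu), Real.exp_log (hpos _ hcu)]

theorem hasKappa_of_tendsto_logDeriv (hpos : ∀ u ∈ Ioo (0 : ℝ) 1, 0 < P u)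
    (hd : ∀ x < 0, HasDerivAt (fun x => Real.log (P (Real.exp x))) (L' x) x)
    (hlim : Tendsto L' atBot (𝓝 κ)) : HasKappa P κ := by
  have hratio := fun c (hc : 0 < c) => tendsto_mul_div_of_tendsto_logDeriv hpos hd hlim hc
  refine ⟨⟨fun u => P u / u ^ κ, ⟨⟨1, one_pos, fun u hu => ?_, ?_⟩, fun c hc => ?_⟩, ?_⟩, ?_⟩
  · exact div_pos (hpos u hu) (Real.rpow_pos_of_pos hu.1 κ)
  -- Measurability comes from continuity of `P`, recovered from differentiability of its logarithm.
  · have hcont : ContinuousOn P (Ioo 0 1) := by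
      have h1 : ContinuousOn (fun u => Real.exp (Real.log (P (Real.exp (Real.log u)))))
          (Ioo (0 : ℝ) 1) := by
        intro u hu
        have h2 := (hd _ (Real.log_neg hu.1 hu.2)).continuousAt
        exact (Real.continuous_exp.continuousAt.comp
          (h2.comp (Real.continuousAt_log hu.1.ne'))).continuousWithinAt
      refine h1.congr fun u hu => ?_
      simp only [Real.exp_log hu.1, Real.exp_log (hpos u hu)]
    have hcont2 : ContinuousOn (fun u => P u / u ^ κ) (Ioo 0 1) :=
      hcont.div (fun u hu => (Real.continuousAt_rpow_const u κ (.inl hu.1.ne')).continuousWithinAt)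
        fun u hu => (Real.rpow_pos_of_pos hu.1 κ).ne'
    exact (continuousOn_iff_continuous_domRestrict.1 hcont2).measurable
  · have he : ∀ᶠ u in 𝓝[>] (0 : ℝ), P u = P u / u ^ κ * u ^ κ := by
      filter_upwards [self_mem_nhdsWithin] with u hu
      rw [div_mul_cancel₀ _ (Real.rpow_pos_of_pos hu κ).ne']
    refine Tendsto.congr' (div_eventuallyEq_of_tailEquation he hc).symm ?_
    have := (hratio c hc).mul_const (c ^ (-κ))
    rwa [← Real.rpow_add hc, add_neg_cancel, Real.rpow_zero] at this
  · filter_upwards [self_mem_nhdsWithin] with u hu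
    rw [div_mul_cancel₀ _ (Real.rpow_pos_of_pos hu κ).ne']
  · rintro k ⟨ℓ, hℓ, he⟩
    -- The single scale `c = e` decides: slow variation forces `e^(κ-k) = 1`.
    have hc := Real.exp_pos 1
    have h1 := (hℓ.2 _ hc).congr' (div_eventuallyEq_of_tailEquation he hc)
    have h2 := tendsto_nhds_unique h1 ((hratio _ hc).mul_const _)
    rw [← Real.rpow_add hc, ← Real.exp_mul, one_mul, eq_comm, Real.exp_eq_one_iff] at h2
    linarith

theorem hasChi_of_tendsto_logDeriv
    (hd : ∀ x < 0, HasDerivAt (fun x => Real.log (P (Real.exp x))) (L' x) x)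
    (hlim : Tendsto L' atBot (𝓝 κ)) (hκ : κ ≠ 0) : HasChi P (2 / κ - 1) := by
  have h := (((tendsto_const_nhds (x := (2 : ℝ))).div (tendsto_div_of_tendsto_deriv hd hlim)
    hκ).sub_const 1).comp Real.tendsto_log_nhdsGT_zero
  refine Tendsto.congr' ?_ h
  filter_upwards [self_mem_nhdsWithin] with u hu
  simp only [Function.comp_apply, Pi.div_apply]
  rw [Real.exp_log hu, div_div_eq_mul_div]

/-- With `x = log u` and `L x = log P(eˣ)`, `P(u)/u = exp((L x / x - 1) x)`; the bracket tends to `κ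
- 1 > 0` while `x → -∞`. -/
theorem hasLambda_zero_of_tendsto_logDeriv (hpos : ∀ u ∈ Ioo (0 : ℝ) 1, 0 < P u)
    (hd : ∀ x < 0, HasDerivAt (fun x => Real.log (P (Real.exp x))) (L' x) x)
    (hlim : Tendsto L' atBot (𝓝 κ)) (hκ : 1 < κ) : HasLambda P 0 := by
  have h := Real.tendsto_exp_atBot.comp
    ((((tendsto_div_of_tendsto_deriv hd hlim).sub_const 1).pos_mul_atBot (sub_pos.2 hκ)
      tendsto_id).comp Real.tendsto_log_nhdsGT_zero)
  refine Tendsto.congr' ?_ h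
  filter_upwards [Ioo_mem_nhdsGT one_pos] with u hu
  simp only [Function.comp_apply, id]
  rw [Real.exp_log hu.1, sub_mul, div_mul_cancel₀ _ (Real.log_neg hu.1 hu.2).ne, one_mul,
    Real.exp_sub, Real.exp_log hu.1, Real.exp_log (hpos u hu)]

end TailIndices

/-! ### Tail of the diagonal of the Gaussian copula -/

theorem hasDerivAt_binormal_diag {ρ : ℝ} (hρ : ρ ∈ Ico (0 : ℝ) 1) (s : ℝ) :
    HasDerivAt (fun s => binormal ρ s s)
      (2 * (ϕ s * Φ ((1 - ρ) / Real.sqrt (1 - ρ ^ 2) * s))) s := by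
  convert! hasDerivAt_binormal_comp hρ (hasDerivAt_id s) (hasDerivAt_id s) using 1
  simp only [id]
  rw [show (s - ρ * s) / Real.sqrt (1 - ρ ^ 2) = (1 - ρ) / Real.sqrt (1 - ρ ^ 2) * s by ring]
  ring

theorem binormal_diag_pos {ρ : ℝ} (hρ : ρ ∈ Ico (0 : ℝ) 1) (s : ℝ) : 0 < binormal ρ s s :=
  (binormal_nonneg ρ (s - 1) (s - 1)).trans_lt
    (strictMono_of_hasDerivAt_pos (hasDerivAt_binormal_diag hρ)
      (fun x => mul_pos two_pos (mul_pos (stdNormalPDF_pos x) (stdNormalCDF_pos _)))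
      (by linarith : s - 1 < s))

/-- The function is the logarithmic derivative of the diagonal at `u = Φ s`. With `k =
(1-ρ)/√(1-ρ²)`, l'Hôpital leads to `1 + k²`, which equals `2/(1+ρ)`. -/
theorem tendsto_diag_logDeriv {ρ : ℝ} (hρ : ρ ∈ Ico (0 : ℝ) 1) :
    Tendsto (fun s => 2 * (Φ ((1 - ρ) / Real.sqrt (1 - ρ ^ 2) * s) * Φ s) / binormal ρ s s) atBot
      (𝓝 (2 / (1 + ρ))) := by
  have hr := sqrt_one_sub_sq_pos hρ
  have hr2 := sq_sqrt_one_sub_sq hρ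
  set r := Real.sqrt (1 - ρ ^ 2) with hrdef
  have h1ρ : 0 < 1 - ρ := by linarith [hρ.2]
  have hk : 0 < (1 - ρ) / r := by positivity
  set k := (1 - ρ) / r with hkdef
  have hk2 : 1 + k ^ 2 = 2 / (1 + ρ) := by
    have : 0 < 1 + ρ := by linarith [hρ.1]
    rw [hkdef, div_pow, hr2, show 1 - ρ ^ 2 = (1 - ρ) * (1 + ρ) by ring]
    field_simp
    ring
  have hkbot : Tendsto (fun s : ℝ => k * s) atBot atBot := tendsto_id.const_mul_atBot hk
  refine HasDerivAt.lhopital_zero_atBot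
    (f' := fun s => 2 * (ϕ (k * s) * k * Φ s + Φ (k * s) * ϕ s))
    (g' := fun s => 2 * (ϕ s * Φ (k * s)))
    (.of_forall fun s => ?_) (.of_forall fun s => hasDerivAt_binormal_diag hρ s)
    (.of_forall fun s =>
      (mul_pos two_pos (mul_pos (stdNormalPDF_pos s) (stdNormalCDF_pos _))).ne') ?_ ?_ ?_
  · have h := (hasDerivAt_stdNormalCDF (k * s)).comp s ((hasDerivAt_id s).const_mul k)
    simpa using (h.mul (hasDerivAt_stdNormalCDF s)).const_mul 2
  · simpa using ((tendsto_stdNormalCDF_atBot.comp hkbot).mul tendsto_stdNormalCDF_atBot).const_mul 2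
  · exact squeeze_zero (fun s => binormal_nonneg ρ s s) (fun s => binormal_le ρ s s)
      tendsto_stdNormalCDF_atBot
  -- The quotient of derivatives is `1 + k ϕ(ks)Φ(s)/(ϕ(s)Φ(ks))`, that is `1 + k²` times the ratio
  -- of `x Φ(x)/ϕ(x)` at `s` and at `ks`, where the ratio tends to `1`.
  · have h := ((tendsto_mul_mills.div (tendsto_mul_mills.comp hkbot) (by norm_num)).const_mul
      (k ^ 2)).const_add 1
    rw [div_self (by norm_num : (-1 : ℝ) ≠ 0), mul_one, hk2] at h
    refine h.congr' ?_
    filter_upwards [eventually_lt_atBot 0] with s hs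
    have e1 := (stdNormalPDF_pos s).ne'
    have e2 := (stdNormalPDF_pos (k * s)).ne'
    have e3 := (stdNormalCDF_pos (k * s)).ne'
    have e4 := hs.ne
    simp only [Function.comp_apply, Pi.div_apply]
    field_simp
    ring

theorem gaussianCopula_diag_pos {ρ : ℝ} (hρ : ρ ∈ Ico (0 : ℝ) 1) {u : ℝ}
    (hu : u ∈ Ioo (0 : ℝ) 1) : 0 < gaussianCopula ρ u u := by
  rw [gaussianCopula_eq hρ hu hu]
  exact binormal_diag_pos hρ _

theorem hasDerivAt_log_gaussianCopula_diag {ρ : ℝ} (hρ : ρ ∈ Ico (0 : ℝ) 1) {x : ℝ} (hx : x < 0) :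
    HasDerivAt (fun x => Real.log (gaussianCopula ρ (Real.exp x) (Real.exp x)))
      (2 * (Φ ((1 - ρ) / Real.sqrt (1 - ρ ^ 2) * realQuantile (Real.exp x)) *
        Φ (realQuantile (Real.exp x))) /
          binormal ρ (realQuantile (Real.exp x)) (realQuantile (Real.exp x))) x := by
  have hmem : ∀ y < 0, Real.exp y ∈ Ioo (0 : ℝ) 1 := fun y hy =>
    ⟨Real.exp_pos y, Real.exp_zero ▸ Real.exp_lt_exp.2 hy⟩
  have hq := (hasDerivAt_realQuantile (hmem x hx)).comp x (Real.hasDerivAt_exp x)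
  have h := ((hasDerivAt_binormal_diag hρ _).comp x hq).log (binormal_diag_pos hρ _).ne'
  refine HasDerivAt.congr_of_eventuallyEq (f := fun x => Real.log
    (binormal ρ (realQuantile (Real.exp x)) (realQuantile (Real.exp x)))) ?_ ?_
  · convert! h using 1
    have e := (stdNormalPDF_pos (realQuantile (Real.exp x))).ne'
    simp only [Function.comp_apply]
    rw [stdNormalCDF_realQuantile (hmem x hx)]
    field_simp
  · filter_upwards [eventually_lt_nhds hx] with y hy
    rw [gaussianCopula_eq hρ (hmem y hy) (hmem y hy)]

theorem corollary1 (ρ : ℝ) (hρ : ρ ∈ Set.Ico (0 : ℝ) 1) :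
    (HasLambdaLStar (gaussianCopula ρ) 0 ∧ HasLambdaL (gaussianCopula ρ) 0) ∧
    (HasChiLStar (gaussianCopula ρ) ρ ∧ HasChiL (gaussianCopula ρ) ρ) ∧
    (HasKappaLStar (gaussianCopula ρ) (2 / (1 + ρ)) ∧
      HasKappaL (gaussianCopula ρ) (2 / (1 + ρ))) := by
  have hρ1 : 0 < 1 + ρ := by linarith [hρ.1]
  have hmax := isMaxDependence_gaussianCopula_id hρ
  have heq : ∀ φ, IsMaxDependence (gaussianCopula ρ) φ →
      (fun u => gaussianCopula ρ u u) =ᶠ[𝓝[>] 0] pathProb (gaussianCopula ρ) φ := by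
    intro φ hφ
    filter_upwards [Ioo_mem_nhdsGT one_pos] with u hu
    rw [hφ.pathProb_eq hmax hu, pathProb_id _ hu]
  have hpos : ∀ u ∈ Ioo (0 : ℝ) 1, 0 < gaussianCopula ρ u u :=
    fun u hu => gaussianCopula_diag_pos hρ hu
  have hd := fun x (hx : x < 0) => hasDerivAt_log_gaussianCopula_diag hρ hx
  have hlim := (tendsto_diag_logDeriv hρ).comp tendsto_realQuantile_exp_atBot
  have hl : HasLambdaL (gaussianCopula ρ) 0 :=
    hasLambda_zero_of_tendsto_logDeriv (P := fun u => gaussianCopula ρ u u) hpos hd hlim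
      (by rw [lt_div_iff₀ hρ1]; linarith [hρ.2])
  have hc : HasChiL (gaussianCopula ρ) ρ := by
    have h := hasChi_of_tendsto_logDeriv (P := fun u => gaussianCopula ρ u u) hd hlim
      (by positivity)
    rwa [div_div_cancel₀ two_ne_zero, add_sub_cancel_left] at h
  have hk : HasKappaL (gaussianCopula ρ) (2 / (1 + ρ)) :=
    hasKappa_of_tendsto_logDeriv (P := fun u => gaussianCopula ρ u u) hpos hd hlim
  exact ⟨⟨⟨⟨_, hmax⟩, fun φ hφ => HasLambda.congr hl (heq φ hφ)⟩, hl⟩,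
    ⟨⟨⟨_, hmax⟩, fun φ hφ => HasChi.congr hc (heq φ hφ)⟩, hc⟩,
    ⟨⟨⟨_, hmax⟩, fun φ hφ => HasKappa.congr hk (heq φ hφ)⟩, hk⟩⟩
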